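/- Let $k$ be a field and let $d\ge 1$ be an integer. A standard graded $k$-algebra is a commutative graded $k$-algebra $R=\bigoplus_{i\ge 0}R_i$ generated over $k$ by finitely many forms of degree one. For a finitely generated graded $R$-module $M$ put $\operatorname{reg} M=\max\{a(H^i_{\mathfrak m}(M))+i \mid i\ge 0\}$, where $H^i_{\mathfrak m}(M)$ is the $i$-th local cohomology module of $M$ with respect to the ideal $\mathfrak m=\bigoplus_{i>0}R_i$ and $a(H)$ is the largest non-vanishing degree of $H$, with $a(0)=-\infty$. If $I$ is a proper ideal of a standard graded $k$-algebra $R$ that is generated by forms of degree $d$ and satisfies $\dim R/I=0$ and $I^n\ne 0$ for all $n\ge 1$, then the sequence $c_n=\operatorname{reg}(I^{n-1}/I^n)-dn+1$, $n\ge 1$, is called the defect sequence of the function $\operatorname{reg} I^{n-1}/I^n$. **Theorem 1.5.** A sequence $(c_n)_{n\ge 1}$ of non-negative integers is the defect sequence of the function $\operatorname{reg} I^{n-1}/I^n$ for some such $R$ and $I$ if and only if it is weakly decreasing. Moreover, let $(b_n)_{n\ge 0}$ be a weakly decreasing sequence of positive integers and let $m\ge 0$ be such that $b_n=b_m$ for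 all $n\ge m$. Then the ring $R=k[x,y]/(x^{b_0},x^{b_1}y^{d},\dots,x^{b_m}y^{dm})$ and its ideal $I=(y^d)$ are as above, and $\operatorname{reg}(I^n/I^{n+1})=d(n+1)+b_n-2$ for all $n\ge 0$; that is, the defect sequence is $c_n=b_{n-1}-1$, $n\ge 1$. -/

import Mathlib

universe u

/-! ### Standard graded algebras -/

/-- `R = ⨁ 𝒜 i` is a standard graded `k`-algebra: it is generated over `k` by finitely many forms of
degree one, i.e. by its component of degree one, which is a finite-dimensional `k`-vector space. -/
class IsStandardGraded {k R : Type*} [Field k] [CommRing R] [Algebra k R]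
    (𝒜 : ℕ → Submodule k R) [GradedAlgebra 𝒜] : Prop where
  finite_one : Module.Finite k (𝒜 1)
  adjoin_one : Algebra.adjoin k (𝒜 1 : Set R) = ⊤

attribute [instance] IsStandardGraded.finite_one

/-- The grading of `R` extended by zero to negative degrees. -/
def intGrading {k R : Type*} [Field k] [CommRing R] [Algebra k R]
    (𝒜 : ℕ → Submodule k R) : ℤ → Submodule k R
  | Int.ofNat i => 𝒜 i
  | Int.negSucc _ => ⊥

/-- A `k`-basis of the linear forms of `R`. It generates the irrelevant ideal `⨁_{i > 0} 𝒜 i` if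
`R` is standard graded. -/
noncomputable def linearForms {k R : Type*} [Field k] [CommRing R] [Algebra k R]
    (𝒜 : ℕ → Submodule k R) [Module.Finite k (𝒜 1)] :
    Fin (Module.finrank k (𝒜 1)) → R :=
  fun i => (Module.finBasis k (𝒜 1) i : R)

/-! ### The Čech complex of a module -/

section Cech

variable {R : Type*} [CommRing R] {r : ℕ}

/-- The multiplicative set generated by the `x i`, `i ∈ s`. Inverting it is the same as inverting
the product of these elements. -/
def cechMonoid (x : Fin r → R) (s : Finset (Fin r)) : Submonoid R :=
  Submonoid.closure (x '' (s : Set (Fin r)))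

theorem cechMonoid_mono (x : Fin r → R) {s t : Finset (Fin r)} (h : s ⊆ t) :
    cechMonoid x s ≤ cechMonoid x t :=
  Submonoid.closure_mono (Set.image_mono (Finset.coe_subset.mpr h))

variable (M : Type*) [AddCommGroup M] [Module R M]

/-- The Čech cochains of degree `p`: the product, over all `i₁ < ⋯ < i_p`, of the localizations of
`M` at `x i₁ ⋯ x i_p`. For `p = 0` this is `M` itself. -/
abbrev CechCochain (x : Fin r → R) (p : ℕ) : Type _ :=
  ∀ s : {s : Finset (Fin r) // s.card = p}, LocalizedModule (cechMonoid x s.1) M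

/-- The Čech differential: the component at `s` of the image of `c` is the alternating sum over
`i ∈ s` of the images of the components of `c` at `s \ {i}`, where `i` has the sign `(-1) ^ a` with
`a` the number of the elements of `s` smaller than `i`. -/
noncomputable def cechD (x : Fin r → R) (p : ℕ) :
    CechCochain M x p →ₗ[R] CechCochain M x (p + 1) :=
  LinearMap.pi fun s => ∑ i : {i // i ∈ s.1},
    (-1 : R) ^ (s.1.filter (· < i.1)).card •
      (LocalizedModule.liftOfLE (M := M) (cechMonoid x (s.1.erase i.1)) (cechMonoid x s.1)
        (cechMonoid_mono x (s.1.erase_subset i.1))).comp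
      (LinearMap.proj (⟨s.1.erase i.1, by rw [Finset.card_erase_of_mem i.2, s.2]; rfl⟩ :
        {s : Finset (Fin r) // s.card = p}))

end Cech

/-! ### Graded local cohomology and Castelnuovo-Mumford regularity -/

section Graded

variable {k R : Type*} [Field k] [CommRing R] [Algebra k R] (𝒜 : ℕ → Submodule k R)
  {M : Type*} [AddCommGroup M] [Module k M] [Module R M] (ℳ : ℤ → Submodule k M)

/-- The component of degree `j` of a localization of the graded module `M`: it consists of the
fractions `m / f` with `m` and `f` homogeneous and `deg m - deg f = j`. -/
def localizedDegree (S : Submonoid R) (j : ℤ) : AddSubgroup (LocalizedModule S M) :=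
  AddSubgroup.closure {z | ∃ (b : ℕ) (f : S) (m : M),
    (f : R) ∈ 𝒜 b ∧ m ∈ ℳ (j + b) ∧ z = LocalizedModule.mk m f}

/-- The Čech cochains (with respect to a sequence of forms) of internal degree `j`. -/
def cechDegree {r : ℕ} (x : Fin r → R) (p : ℕ) (j : ℤ) : AddSubgroup (CechCochain M x p) :=
  AddSubgroup.pi Set.univ fun s => localizedDegree 𝒜 ℳ (cechMonoid x s.1) j

/-- The Čech cocycles of internal degree `j`. -/
noncomputable def cechCocycles {r : ℕ} (x : Fin r → R) (p : ℕ) (j : ℤ) :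
    AddSubgroup (CechCochain M x p) :=
  (cechD M x p).toAddMonoidHom.ker ⊓ cechDegree 𝒜 ℳ x p j

/-- The Čech coboundaries of internal degree `j`. -/
noncomputable def cechCoboundaries {r : ℕ} (x : Fin r → R) (j : ℤ) :
    (p : ℕ) → AddSubgroup (CechCochain M x p)
  | 0 => ⊥
  | p + 1 => (cechDegree 𝒜 ℳ x p j).map (cechD M x p).toAddMonoidHom

variable [Module.Finite k (𝒜 1)]

/-- The component of degree `j` of the `p`-th local cohomology module of the graded module `M` with
respect to the irrelevant ideal of the standard graded algebra `R`, computed by the graded Čech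
complex of `M` on a basis of the linear forms of `R`. -/
abbrev LocalCohomologyDegree (p : ℕ) (j : ℤ) : Type _ :=
  cechCocycles 𝒜 ℳ (linearForms 𝒜) p j ⧸
    (cechCoboundaries 𝒜 ℳ (linearForms 𝒜) j p).addSubgroupOf
      (cechCocycles 𝒜 ℳ (linearForms 𝒜) p j)

/-- The largest degree in which the `p`-th local cohomology module of `M` does not vanish, which is
`⊥ = -∞` if the module is zero. -/
noncomputable def localCohomologyTop (p : ℕ) : WithBot (WithTop ℤ) :=
  ⨆ (j : ℤ) (_ : Nontrivial (LocalCohomologyDegree 𝒜 ℳ p j)), ((j : WithTop ℤ) : WithBot (WithTop ℤ))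

/-- The Castelnuovo-Mumford regularity `max {a(H^p(M)) + p | p ≥ 0}` of the graded `R`-module
`M`, where `a(H^p(M))` is the largest non-vanishing degree of its `p`-th local cohomology. -/
noncomputable def cmReg : WithBot (WithTop ℤ) :=
  ⨆ p : ℕ, (localCohomologyTop 𝒜 ℳ p + (((p : ℤ) : WithTop ℤ) : WithBot (WithTop ℤ)))

end Graded

/-! ### Powers of an ideal and the defect sequence -/

section Ideals

variable {k R : Type*} [Field k] [CommRing R] [Algebra k R] (𝒜 : ℕ → Submodule k R)

/-- The `R`-module `J / K` for ideals `K ≤ J` of `R`. -/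
abbrev IdealQuotient (J K : Ideal R) : Type _ := J ⧸ Submodule.submoduleOf K J

/-- The grading of `J / K` for homogeneous ideals `K ≤ J` of `R`: the component of degree `j`
consists of the classes of the elements of `J` of degree `j`. -/
def idealQuotientGrading (J K : Ideal R) (j : ℤ) : Submodule k (IdealQuotient J K) :=
  ((intGrading 𝒜 j).comap (J.subtype.restrictScalars k)).map
    ((Submodule.submoduleOf K J).mkQ.restrictScalars k)

/-- The ideal `I` is generated by forms of degree `d`. -/
def IsGeneratedInDegree (d : ℕ) (I : Ideal R) : Prop :=
  ∃ T : Set R, T ⊆ (𝒜 d : Set R) ∧ I = Ideal.span T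

/-- The ideals under consideration: proper ideals `I` generated by forms of degree `d`, such that no
power of `I` is zero and `dim R / I = 0`. -/
structure IsEquigeneratedDimZero (d : ℕ) (I : Ideal R) : Prop where
  generated : IsGeneratedInDegree 𝒜 d I
  ne_top : I ≠ ⊤
  pow_ne_bot : ∀ n : ℕ, 1 ≤ n → I ^ n ≠ ⊥
  dim_eq_zero : ringKrullDim (R ⧸ I) = 0

/-- The function `n ↦ reg (I ^ (n - 1) / I ^ n)`, for `n ≥ 1`. -/
noncomputable def regPowQuotient [Module.Finite k (𝒜 1)] (I : Ideal R) (n : ℕ) :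
    WithBot (WithTop ℤ) :=
  cmReg 𝒜 (idealQuotientGrading 𝒜 (I ^ (n - 1)) (I ^ n))

/-- The sequence `c 1, c 2, …` is the defect sequence of the function `reg (I ^ (n - 1) / I ^ n)`,
for an ideal `I` generated by forms of degree `d`: `c n = reg (I ^ (n - 1) / I ^ n) - d n + 1` for
all `n ≥ 1`. The value `c 0` plays no role. -/
def IsDefectSequence [Module.Finite k (𝒜 1)] (d : ℕ) (I : Ideal R) (c : ℕ → ℕ) : Prop :=
  ∀ n : ℕ, 1 ≤ n →
    regPowQuotient 𝒜 I n = (((c n : ℤ) + d * n - 1 : ℤ) : WithTop ℤ)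

end Ideals

/-! ### The explicit rings -/

section Explicit

variable (k : Type u) [Field k]

open MvPolynomial in
/-- The ideal `(x ^ b₀, x ^ b₁ y ^ d, …, x ^ b_m y ^ (d m))` of `k[x, y]`, with `x = X 0`,
`y = X 1`. -/
noncomputable def stairIdeal (d m : ℕ) (b : ℕ → ℕ) : Ideal (MvPolynomial (Fin 2) k) :=
  Ideal.span {f | ∃ i ≤ m, f = X 0 ^ b i * X 1 ^ (d * i)}

/-- The quotient of `k[x, y]` by the ideal `(x ^ b₀, x ^ b₁ y ^ d, …, x ^ b_m y ^ (d m))`. -/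
abbrev StairRing (d m : ℕ) (b : ℕ → ℕ) : Type u :=
  MvPolynomial (Fin 2) k ⧸ stairIdeal k d m b

/-- The grading of `StairRing` induced by the standard grading of `k[x, y]`. -/
noncomputable def stairGrading (d m : ℕ) (b : ℕ → ℕ) (i : ℕ) : Submodule k (StairRing k d m b) :=
  (MvPolynomial.homogeneousSubmodule (Fin 2) k i).map
    (Ideal.Quotient.mkₐ k (stairIdeal k d m b)).toLinearMap

/-- The ideal of `StairRing` generated by the class of `y ^ d`. -/
noncomputable def stairPowerIdeal (d m : ℕ) (b : ℕ → ℕ) : Ideal (StairRing k d m b) :=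
  Ideal.span {Ideal.Quotient.mk (stairIdeal k d m b) (MvPolynomial.X 1 ^ d)}

end Explicit

/-! Since `R / I` has dimension zero, every linear form is nilpotent modulo `I`, hence acts
nilpotently on `I ^ n / I ^ (n + 1)`. All localizations in positive Čech degree then vanish, and
only `H^0`, the module itself, survives. So the regularity is the supremum of the degrees in which
`I ^ n` has a form outside `I ^ (n + 1)` (`cmReg_eq_iSup`, `regPowQuotient_eq_iSup`).

Necessity: `I ^ (n + 1) = I * I ^ n` with `I` generated in degree `d`. If all forms of degree `j -
d` in `I ^ n` lay in `I ^ (n + 1)`, all forms of degree `j` in `I ^ (n + 1)` would lie in `I ^ (n +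
2)`. Hence the top degree grows by at most `d` at each step, and the defect cannot increase
(`exists_mem_pow_notMem_pow_of_succ`).

Sufficiency: in the staircase ring, `I ^ n / I ^ (n + 1)` has as basis the monomials `x ^ u * y ^ (d
* n + v)` with `u < b n` and `v < d`. Its top degree is `(b n - 1) + (d - 1) + d * n`, so `b n = c
(n + 1) + 1` realizes `c`. -/

/-! ### Local cohomology of modules on which the linear forms are locally nilpotent. -/

section LocalCohomology

variable {k R : Type*} [Field k] [CommRing R] [Algebra k R] (𝒜 : ℕ → Submodule k R)
  {M : Type*} [AddCommGroup M] [Module k M] [Module R M] (ℳ : ℤ → Submodule k M)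

theorem subsingleton_localizedModule_of_locally_nilpotent {S : Submonoid R} {x : R} (hx : x ∈ S)
    (h : ∀ m : M, ∃ n : ℕ, x ^ n • m = 0) : Subsingleton (LocalizedModule S M) := by
  refine subsingleton_of_forall_eq 0 fun z => ?_
  induction z using LocalizedModule.induction_on with
  | h m s =>
    obtain ⟨n, hn⟩ := h m
    rw [← LocalizedModule.zero_mk s, LocalizedModule.mk_eq]
    refine ⟨⟨x ^ n, pow_mem hx n⟩, ?_⟩
    rw [smul_comm]
    simp [Submonoid.smul_def, hn]

theorem subsingleton_cechCochain_succ {r : ℕ} {x : Fin r → R}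
    (h : ∀ i, ∀ m : M, ∃ n : ℕ, x i ^ n • m = 0) (p : ℕ) :
    Subsingleton (CechCochain M x (p + 1)) := by
  refine @Pi.instSubsingleton _ _ fun s => ?_
  obtain ⟨i, hi⟩ : s.1.Nonempty := Finset.card_pos.mp (by rw [s.2]; omega)
  exact subsingleton_localizedModule_of_locally_nilpotent
    (Submonoid.subset_closure ⟨i, hi, rfl⟩) (h i)

theorem localizedDegree_bot_eq_bot_iff [GradedAlgebra 𝒜] {S : Submonoid R} (hS : S = ⊥) (j : ℤ) :
    localizedDegree 𝒜 ℳ S j = ⊥ ↔ ℳ j = ⊥ := by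
  subst hS
  have hmk (m : M) : LocalizedModule.mk m (1 : (⊥ : Submonoid R)) = 0 ↔ m = 0 := by
    rw [← LocalizedModule.zero_mk (1 : (⊥ : Submonoid R)), LocalizedModule.mk_eq]
    refine ⟨?_, fun h => ⟨1, by rw [h]⟩⟩
    rintro ⟨u, hu⟩
    rw [show u = 1 from Subtype.ext (Submonoid.mem_bot.mp u.2)] at hu
    simpa using hu
  rw [localizedDegree, AddSubgroup.closure_eq_bot_iff, Submodule.eq_bot_iff]
  constructor
  · intro h m hm
    exact (hmk m).mp (h ⟨0, 1, m, SetLike.GradedOne.one_mem, by simpa using hm, rfl⟩)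
  · rintro h _ ⟨b, f, m, hf, hm, rfl⟩
    obtain rfl : f = 1 := Subtype.ext (Submonoid.mem_bot.mp f.2)
    rw [Set.mem_singleton_iff, hmk]
    rcases eq_or_ne b 0 with rfl | hb
    · exact h m (by simpa using hm)
    -- The only denominator is `1`; if it also lies in a nonzero degree, the ring is zero and so is
    -- `M`.
    · have h1 : (1 : R) = 0 := by
        have h0 : (1 : R) ∈ 𝒜 0 := SetLike.GradedOne.one_mem
        rw [← DirectSum.decompose_of_mem_same 𝒜 h0]
        exact DirectSum.decompose_of_mem_ne 𝒜 hf hb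
      rw [← one_smul R m, h1, zero_smul]

/-- The cochains of degree one vanish, so every cochain of degree zero is a cocycle; there are no
coboundaries, and the only index set is empty, where nothing is inverted. -/
theorem nontrivial_localCohomologyDegree_zero_iff [GradedAlgebra 𝒜] [Module.Finite k (𝒜 1)]
    (h : ∀ x ∈ 𝒜 1, ∀ m : M, ∃ n : ℕ, x ^ n • m = 0) (j : ℤ) :
    Nontrivial (LocalCohomologyDegree 𝒜 ℳ 0 j) ↔ ℳ j ≠ ⊥ := by
  have hsub : Subsingleton (CechCochain M (linearForms 𝒜) (0 + 1)) :=
    subsingleton_cechCochain_succ (fun i => h _ (Subtype.mem _)) 0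
  have hS (s : {s : Finset (Fin (Module.finrank k (𝒜 1))) // s.card = 0}) :
      cechMonoid (linearForms 𝒜) s.1 = ⊥ := by
    simp [cechMonoid, Finset.card_eq_zero.mp s.2]
  have hcoc : cechCocycles 𝒜 ℳ (linearForms 𝒜) 0 j = cechDegree 𝒜 ℳ (linearForms 𝒜) 0 j :=
    inf_eq_right.mpr fun c _ => Subsingleton.elim _ _
  rw [← not_iff_not, not_nontrivial_iff_subsingleton, not_not, QuotientAddGroup.subsingleton_iff]
  have hcob : cechCoboundaries 𝒜 ℳ (linearForms 𝒜) j 0 = ⊥ := rfl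
  rw [hcob, AddSubgroup.addSubgroupOf_eq_top, le_bot_iff, hcoc, AddSubgroup.eq_bot_iff_forall]
  let s₀ : {s : Finset (Fin (Module.finrank k (𝒜 1))) // s.card = 0} := ⟨∅, rfl⟩
  constructor
  · intro H
    rw [← localizedDegree_bot_eq_bot_iff 𝒜 ℳ (hS s₀), AddSubgroup.eq_bot_iff_forall]
    intro z hz
    have hs (s : {s : Finset (Fin (Module.finrank k (𝒜 1))) // s.card = 0}) : s = s₀ :=
      Subtype.ext (Finset.card_eq_zero.mp s.2)
    have := H (fun s => (hs s).symm ▸ z) (by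
      intro s _
      obtain rfl := hs s
      exact hz)
    exact congrFun this s₀
  · intro H c hc
    funext s
    have := (localizedDegree_bot_eq_bot_iff 𝒜 ℳ (hS s) j).mpr H
    have hcs := hc s (Set.mem_univ s)
    simpa [this] using hcs

/-- The regularity of a graded module on which the linear forms act locally nilpotently is its
largest non-vanishing degree. -/
theorem cmReg_eq_iSup [GradedAlgebra 𝒜] [Module.Finite k (𝒜 1)]
    (h : ∀ x ∈ 𝒜 1, ∀ m : M, ∃ n : ℕ, x ^ n • m = 0) :
    cmReg 𝒜 ℳ = ⨆ (j : ℤ) (_ : ℳ j ≠ ⊥), ((j : WithTop ℤ) : WithBot (WithTop ℤ)) := by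
  have htop : localCohomologyTop 𝒜 ℳ 0 =
      ⨆ (j : ℤ) (_ : ℳ j ≠ ⊥), ((j : WithTop ℤ) : WithBot (WithTop ℤ)) := by
    simp only [localCohomologyTop, nontrivial_localCohomologyDegree_zero_iff 𝒜 ℳ h]
  have hsucc (p : ℕ) : localCohomologyTop 𝒜 ℳ (p + 1) = ⊥ := by
    have := subsingleton_cechCochain_succ (x := linearForms 𝒜) (M := M)
      (fun i => h _ (Subtype.mem _)) p
    simp only [localCohomologyTop, iSup_eq_bot]
    intro j hj
    exact absurd hj (not_nontrivial_iff_subsingleton.mpr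
      (QuotientAddGroup.mk_surjective.subsingleton))
  rw [← htop]
  refine le_antisymm (iSup_le fun p => ?_) (le_iSup_of_le 0 ?_)
  · cases p with
    | zero => simp
    | succ p => simp [hsucc p]
  · simp

end LocalCohomology

/-! ### Regularity of the power quotients and monotonicity of the defect. -/

section PowerQuotients

variable {k R : Type*} [Field k] [CommRing R] [Algebra k R] (𝒜 : ℕ → Submodule k R)

theorem idealQuotientGrading_ne_bot_iff (J K : Ideal R) (j : ℤ) :
    idealQuotientGrading 𝒜 J K j ≠ ⊥ ↔ ∃ f ∈ intGrading 𝒜 j, f ∈ J ∧ f ∉ K := by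
  rw [← not_iff_not, not_not, idealQuotientGrading, Submodule.eq_bot_iff]
  push Not
  constructor
  · intro h f hf hJ
    exact (Submodule.Quotient.mk_eq_zero (Submodule.submoduleOf K J)).mp
      (h _ ⟨⟨f, hJ⟩, hf, rfl⟩)
  · rintro h _ ⟨f, hf, rfl⟩
    exact (Submodule.Quotient.mk_eq_zero (Submodule.submoduleOf K J)).mpr (h f hf f.2)

theorem Ideal.IsHomogeneous.pow [GradedAlgebra 𝒜] {I : Ideal R} (hI : I.IsHomogeneous 𝒜) (n : ℕ) :
    (I ^ n).IsHomogeneous 𝒜 := by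
  induction n with
  | zero => simpa using Ideal.IsHomogeneous.top 𝒜
  | succ n ih => rw [pow_succ]; exact ih.mul hI

theorem IsGeneratedInDegree.isHomogeneous [GradedAlgebra 𝒜] {d : ℕ} {I : Ideal R}
    (hI : IsGeneratedInDegree 𝒜 d I) : I.IsHomogeneous 𝒜 := by
  obtain ⟨T, hT, rfl⟩ := hI
  exact Ideal.homogeneous_span 𝒜 T fun t ht => ⟨d, hT ht⟩

/-- If `R / I` is zero-dimensional, then the forms of positive degree are nilpotent modulo the
homogeneous ideal `I`. -/
theorem mem_radical_of_ringKrullDim_quotient_eq_zero [GradedAlgebra 𝒜] {I : Ideal R}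
    (hI : I.IsHomogeneous 𝒜) (hdim : ringKrullDim (R ⧸ I) = 0) {i : ℕ} (hi : i ≠ 0) {x : R}
    (hx : x ∈ 𝒜 i) : x ∈ I.radical := by
  have hdim' : Ring.KrullDimLE 0 (R ⧸ I) := Ring.krullDimLE_iff.mpr hdim.le
  rw [Ideal.radical_eq_sInf, Submodule.mem_sInf]
  rintro P ⟨hIP, hP⟩
  -- The homogeneous core of a prime over `I` is again a prime over `I`, hence maximal by
  -- zero-dimensionality.
  refine Ideal.toIdeal_homogeneousCore_le 𝒜 P ?_
  set Q := (Ideal.homogeneousCore 𝒜 P).toIdeal with hQ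
  have hQhom : Q.IsHomogeneous 𝒜 := (Ideal.homogeneousCore 𝒜 P).isHomogeneous
  have hQprime : Q.IsPrime := Ideal.IsPrime.homogeneousCore hP
  have hIQ : I ≤ Q := by
    rw [← hI.toIdeal_homogeneousCore_eq_self]
    exact Ideal.homogeneousCore_mono 𝒜 hIP
  have hmap : (Q.map (Ideal.Quotient.mk I)).IsPrime :=
    Ideal.map_isPrime_of_surjective Ideal.Quotient.mk_surjective (by simpa using hIQ)
  have hQmax : Q.IsMaximal := by
    have := Ideal.comap_isMaximal_of_surjective (Ideal.Quotient.mk I)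
      Ideal.Quotient.mk_surjective (K := Q.map (Ideal.Quotient.mk I)) (H := hmap.isMaximal')
    rwa [Ideal.comap_map_of_surjective _ Ideal.Quotient.mk_surjective, ← RingHom.ker_eq_comap_bot,
      Ideal.mk_ker, sup_eq_left.mpr hIQ] at this
  by_contra hxQ
  -- Write `1 = y * x + q` with `q ∈ Q`. As `x` has positive degree, `y * x` has no component of
  -- degree zero, so `1` is that component of `q` and lies in `Q`.
  obtain ⟨y, hy⟩ := hQmax.exists_inv hxQ
  obtain ⟨q, hq, hyq⟩ := hy
  have h0 : ((DirectSum.decompose 𝒜 (1 : R)) 0 : R) = 1 :=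
    DirectSum.decompose_of_mem_same 𝒜 SetLike.GradedOne.one_mem
  refine hQprime.ne_top ((Ideal.eq_top_iff_one _).mpr ?_)
  rw [← h0, ← hyq, DirectSum.decompose_add, DirectSum.add_apply, Submodule.coe_add,
    DirectSum.coe_decompose_mul_of_right_mem_of_not_le 𝒜 hx (by omega), zero_add]
  exact hQhom 0 hq

theorem regPowQuotient_eq_iSup [GradedAlgebra 𝒜] [Module.Finite k (𝒜 1)] {d : ℕ} {I : Ideal R}
    (hI : IsEquigeneratedDimZero 𝒜 d I) (n : ℕ) :
    regPowQuotient 𝒜 I (n + 1) =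
      ⨆ (j : ℤ) (_ : ∃ f ∈ intGrading 𝒜 j, f ∈ I ^ n ∧ f ∉ I ^ (n + 1)),
        ((j : WithTop ℤ) : WithBot (WithTop ℤ)) := by
  rw [regPowQuotient, cmReg_eq_iSup]
  · simp only [idealQuotientGrading_ne_bot_iff, Nat.add_sub_cancel]
  · intro x hx m
    obtain ⟨N, hN⟩ := mem_radical_of_ringKrullDim_quotient_eq_zero 𝒜 hI.generated.isHomogeneous
      hI.dim_eq_zero one_ne_zero hx
    refine ⟨N, ?_⟩
    induction m using Submodule.Quotient.induction_on with
    | _ m =>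
      rw [← Submodule.Quotient.mk_smul, Submodule.Quotient.mk_eq_zero]
      change x ^ N * (m : R) ∈ I ^ (n + 1 - 1 + 1)
      rw [pow_succ']
      exact Ideal.mul_mem_mul hN m.2

/-- For a generator `t` of degree `d`, the component of `t * g` in degree `j` is `t` times that of
`g` in degree `j - d`, and is zero if `j < d`. Coefficients are absorbed into `g ∈ J`. -/
theorem decompose_mul_mem_of_forall_mem [GradedAlgebra 𝒜] {T : Set R} {d j : ℕ}
    (hT : T ⊆ (𝒜 d : Set R)) {J K : Ideal R} (hJ : J.IsHomogeneous 𝒜)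
    (h : d ≤ j → ∀ g ∈ 𝒜 (j - d), g ∈ J → g ∈ K) {f : R} (hf : f ∈ Ideal.span T * J) :
    (DirectSum.decompose 𝒜 f j : R) ∈ Ideal.span T * K := by
  induction hf using Submodule.mul_induction_on' with
  | add a _ b _ ha hb =>
    rw [DirectSum.decompose_add, DirectSum.add_apply, Submodule.coe_add]
    exact add_mem ha hb
  | mem_mul_mem a ha g hg =>
    induction ha using Submodule.span_induction generalizing g with
    | zero => simp
    | add a b _ _ iha ihb =>
      rw [add_mul, DirectSum.decompose_add, DirectSum.add_apply, Submodule.coe_add]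
      exact add_mem (iha g hg) (ihb g hg)
    | smul r a _ ih =>
      rw [smul_eq_mul, mul_comm r, mul_assoc]
      exact ih _ (J.mul_mem_left r hg)
    | mem t ht =>
      by_cases hdj : d ≤ j
      · rw [DirectSum.coe_decompose_mul_of_left_mem_of_le 𝒜 (hT ht) hdj]
        exact Ideal.mul_mem_mul (Ideal.subset_span ht) (h hdj _ (Subtype.mem _) (hJ _ hg))
      · rw [DirectSum.coe_decompose_mul_of_left_mem_of_not_le 𝒜 (hT ht) hdj]
        exact zero_mem _

theorem exists_mem_pow_notMem_pow_of_succ [GradedAlgebra 𝒜] {d : ℕ} {I : Ideal R}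
    (hI : IsGeneratedInDegree 𝒜 d I) {n : ℕ} {j : ℤ}
    (h : ∃ f ∈ intGrading 𝒜 j, f ∈ I ^ (n + 1) ∧ f ∉ I ^ (n + 2)) :
    ∃ f ∈ intGrading 𝒜 (j - d), f ∈ I ^ n ∧ f ∉ I ^ (n + 1) := by
  obtain ⟨f, hfj, hf, hf'⟩ := h
  cases j with
  | negSucc j => exact absurd (show f = 0 from hfj) fun h0 => hf' (h0 ▸ zero_mem _)
  | ofNat j =>
    by_contra! H
    have hfj' : f ∈ 𝒜 j := hfj
    have hhom := hI.isHomogeneous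
    obtain ⟨T, hT, rfl⟩ := hI
    rw [pow_succ'] at hf
    refine hf' ?_
    rw [pow_succ', ← DirectSum.decompose_of_mem_same 𝒜 hfj']
    refine decompose_mul_mem_of_forall_mem 𝒜 hT (hhom.pow 𝒜 n) (fun hdj g hg => H g ?_) hf
    rw [Int.ofNat_eq_natCast, ← Nat.cast_sub hdj]
    exact hg

theorem IsDefectSequence.antitoneOn [GradedAlgebra 𝒜] [Module.Finite k (𝒜 1)] {d : ℕ} {I : Ideal R}
    (hI : IsEquigeneratedDimZero 𝒜 d I) {c : ℕ → ℕ} (hc : IsDefectSequence 𝒜 d I c) :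
    AntitoneOn c (Set.Ici 1) := by
  have hstep (n : ℕ) : c (n + 1 + 1) ≤ c (n + 1) := by
    have h₁ := hc (n + 1) (by omega)
    have h₂ := hc (n + 1 + 1) (by omega)
    rw [regPowQuotient_eq_iSup 𝒜 hI] at h₁ h₂
    have hle : (((c (n + 1 + 1) + d * (n + 1 + 1 : ℕ) - 1 : ℤ) : WithTop ℤ) : WithBot (WithTop ℤ)) ≤
        (((c (n + 1) + d * (n + 1 : ℕ) - 1 + d : ℤ) : WithTop ℤ) : WithBot (WithTop ℤ)) := by
      rw [← h₂]
      refine iSup₂_le fun j hj => ?_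
      have := le_iSup₂ (f := fun (j : ℤ)
        (_ : ∃ f ∈ intGrading 𝒜 j, f ∈ I ^ n ∧ f ∉ I ^ (n + 1)) =>
          ((j : WithTop ℤ) : WithBot (WithTop ℤ))) (j - d)
        (exists_mem_pow_notMem_pow_of_succ 𝒜 hI.generated hj)
      rw [h₁] at this
      simp only [WithBot.coe_le_coe, WithTop.coe_le_coe] at this ⊢
      linarith
    simp only [WithBot.coe_le_coe, WithTop.coe_le_coe] at hle
    push_cast at hle
    have : (c (n + 1 + 1) : ℤ) ≤ c (n + 1) := by linarith
    exact_mod_cast this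
  intro a ha b _ hab
  induction b, hab using Nat.le_induction with
  | base => exact le_rfl
  | succ b hab ih =>
    have ha' : 1 ≤ a := ha
    obtain ⟨b, rfl⟩ : ∃ b', b = b' + 1 := ⟨b - 1, by omega⟩
    exact (hstep b).trans (ih (by simp))

end PowerQuotients

/-! ### The grading of a quotient by a homogeneous ideal. -/

section QuotientGrading

open DirectSum

variable {k A : Type*} [CommRing k] [CommRing A] [Algebra k A] (𝒜 : ℕ → Submodule k A)

/-- The map induced on the direct sums of the homogeneous components by the quotient map of a
graded algebra. -/
noncomputable def decomposeQuotientAux [GradedAlgebra 𝒜] (I : Ideal A) :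
    A →ₗ[k] ⨁ i, (𝒜 i).map (Ideal.Quotient.mkₐ k I).toLinearMap :=
  lmap (fun i => (Ideal.Quotient.mkₐ k I).toLinearMap.submoduleMap (𝒜 i)) ∘ₗ
    (decomposeLinearEquiv 𝒜).toLinearMap

theorem decomposeQuotientAux_of_mem [GradedAlgebra 𝒜] (I : Ideal A) {i : ℕ} {a : A}
    (ha : a ∈ 𝒜 i) : decomposeQuotientAux 𝒜 I a =
      lof k ℕ (fun i => (𝒜 i).map (Ideal.Quotient.mkₐ k I).toLinearMap) i ⟨_, a, ha, rfl⟩ := by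
  change lmap _ (decompose 𝒜 a) = _
  rw [decompose_of_mem 𝒜 ha, lmap_of]
  rfl

/-- The decomposition into homogeneous components of the elements of the quotient of a graded
algebra by a homogeneous ideal. -/
noncomputable def decomposeQuotient [GradedAlgebra 𝒜] {I : Ideal A} (hI : I.IsHomogeneous 𝒜) :
    (A ⧸ I) →+ ⨁ i, (𝒜 i).map (Ideal.Quotient.mkₐ k I).toLinearMap :=
  QuotientAddGroup.lift I.toAddSubgroup (decomposeQuotientAux 𝒜 I).toAddMonoidHom fun _ hx =>
    DFinsupp.ext fun i => Subtype.ext (Ideal.Quotient.eq_zero_iff_mem.mpr (hI i hx))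

theorem decomposeQuotient_mk [GradedAlgebra 𝒜] {I : Ideal A} (hI : I.IsHomogeneous 𝒜) (a : A) :
    decomposeQuotient 𝒜 hI (Ideal.Quotient.mk I a) = decomposeQuotientAux 𝒜 I a :=
  rfl

/-- The quotient of a graded algebra by a homogeneous ideal is graded by the images of the
homogeneous components. -/
noncomputable abbrev quotientGradedAlgebra [GradedAlgebra 𝒜] {I : Ideal A}
    (hI : I.IsHomogeneous 𝒜) :
    GradedAlgebra fun i => (𝒜 i).map (Ideal.Quotient.mkₐ k I).toLinearMap where
  one_mem := ⟨1, SetLike.GradedOne.one_mem, rfl⟩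
  mul_mem := by
    rintro i j _ _ ⟨a, ha, rfl⟩ ⟨b, hb, rfl⟩
    exact ⟨a * b, SetLike.GradedMul.mul_mem ha hb, rfl⟩
  decompose' := decomposeQuotient 𝒜 hI
  left_inv z := by
    obtain ⟨a, rfl⟩ := Ideal.Quotient.mk_surjective z
    induction a using Decomposition.inductionOn 𝒜 with
    | zero => simp
    | add a b ha hb => rw [map_add, map_add, map_add, ha, hb]
    | homogeneous a =>
      rw [decomposeQuotient_mk, decomposeQuotientAux_of_mem 𝒜 I a.2]
      exact coeAddMonoidHom_of _ _ _
  right_inv z := by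
    induction z using DirectSum.induction_on with
    | zero => simp
    | add a b ha hb => rw [map_add, map_add, ha, hb]
    | of i x =>
      obtain ⟨_, a, ha, rfl⟩ := x
      rw [coeAddMonoidHom_of]
      exact (decomposeQuotient_mk 𝒜 hI a).trans (decomposeQuotientAux_of_mem 𝒜 I ha)

end QuotientGrading

/-! ### The staircase rings. -/

section Stair

variable (k : Type u) [Field k]

open MvPolynomial

theorem X_pow_mul_X_pow_eq_monomial (a c : ℕ) :
    (X 0 ^ a * X 1 ^ c : MvPolynomial (Fin 2) k) =
      monomial (Finsupp.single 0 a + Finsupp.single 1 c) 1 := by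
  rw [X_pow_eq_monomial, X_pow_eq_monomial, monomial_mul, one_mul]

theorem X_pow_mul_X_pow_mem_span_iff (E : Set (ℕ × ℕ)) (a c : ℕ) :
    (X 0 ^ a * X 1 ^ c : MvPolynomial (Fin 2) k) ∈
      Ideal.span ((fun p : ℕ × ℕ => X 0 ^ p.1 * X 1 ^ p.2) '' E) ↔
        ∃ p ∈ E, p.1 ≤ a ∧ p.2 ≤ c := by
  have himage : (fun p : ℕ × ℕ => (X 0 ^ p.1 * X 1 ^ p.2 : MvPolynomial (Fin 2) k)) '' E =
      (fun s => monomial s (1 : k)) ''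
        ((fun p : ℕ × ℕ => Finsupp.single (0 : Fin 2) p.1 + Finsupp.single 1 p.2) '' E) := by
    rw [Set.image_image]
    simp only [X_pow_mul_X_pow_eq_monomial]
  classical
  rw [himage, X_pow_mul_X_pow_eq_monomial, mem_ideal_span_monomial_image,
    support_monomial, if_neg one_ne_zero]
  simp [Finsupp.le_def, Fin.forall_fin_two]

variable (d m : ℕ) (b : ℕ → ℕ)

theorem stairIdeal_isHomogeneous :
    letI := gradedAlgebra (σ := Fin 2) (R := k)
    (stairIdeal k d m b).IsHomogeneous (homogeneousSubmodule (Fin 2) k) := by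
  let := gradedAlgebra (σ := Fin 2) (R := k)
  refine Ideal.homogeneous_span _ _ ?_
  rintro _ ⟨i, _, rfl⟩
  exact ⟨b i + d * i, (isHomogeneous_X_pow 0 _).mul (isHomogeneous_X_pow 1 _)⟩

/-- The grading of `StairRing` induced by that of `k[x, y]` is an algebra grading. -/
noncomputable abbrev stairGradedAlgebra : GradedAlgebra (stairGrading k d m b) :=
  letI := gradedAlgebra (σ := Fin 2) (R := k)
  quotientGradedAlgebra (homogeneousSubmodule (Fin 2) k) (stairIdeal_isHomogeneous k d m b)

theorem adjoin_image_X_eq_top {A : Type*} [CommRing A] [Algebra k A]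
    {π : MvPolynomial (Fin 2) k →ₐ[k] A} (hπ : Function.Surjective π) :
    Algebra.adjoin k (π '' Set.range X) = ⊤ := by
  rw [← AlgHom.map_adjoin, adjoin_range_X, Algebra.map_top, AlgHom.range_eq_top]
  exact hπ

theorem stairGrading_isStandardGraded :
    letI := stairGradedAlgebra k d m b
    IsStandardGraded (stairGrading k d m b) :=
  let := stairGradedAlgebra k d m b
  { finite_one := Module.Finite.iff_fg.mpr ((homogeneousSubmodule_fg (σ := Fin 2) (R := k) 1).map _)
    adjoin_one := by
      rw [eq_top_iff,
        ← adjoin_image_X_eq_top k (Ideal.Quotient.mkₐ_surjective k (stairIdeal k d m b))]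
      refine Algebra.adjoin_mono ?_
      rintro _ ⟨_, ⟨i, rfl⟩, rfl⟩
      exact ⟨X i, isHomogeneous_X k i, rfl⟩ }

variable {k d m b}

theorem stairPowerIdeal_pow (n : ℕ) : stairPowerIdeal k d m b ^ n =
    Ideal.span {Ideal.Quotient.mk (stairIdeal k d m b) (X 1 ^ (d * n))} := by
  rw [stairPowerIdeal, Ideal.span_singleton_pow, ← map_pow, ← pow_mul]

/-- Beyond `m` the `x`-exponent is constant, so the monomial is a multiple of the last generator. -/
theorem X_pow_mul_X_pow_mem_stairIdeal (hbm : ∀ n, m ≤ n → b n = b m) (n : ℕ) :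
    (X 0 ^ b n * X 1 ^ (d * n) : MvPolynomial (Fin 2) k) ∈ stairIdeal k d m b := by
  rcases le_total n m with h | h
  · exact Ideal.subset_span ⟨n, h, rfl⟩
  · rw [hbm n h, show d * n = d * m + d * (n - m) by rw [← Nat.mul_add]; congr; omega, pow_add,
      ← mul_assoc]
    exact Ideal.mul_mem_right _ _ (Ideal.subset_span ⟨m, le_rfl, rfl⟩)

theorem mk_X_pow_mem_stairPowerIdeal_pow (n : ℕ) (f : MvPolynomial (Fin 2) k) :
    Ideal.Quotient.mk (stairIdeal k d m b) (f * X 1 ^ (d * n)) ∈ stairPowerIdeal k d m b ^ n := by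
  rw [stairPowerIdeal_pow, map_mul]
  exact Ideal.mul_mem_left _ _ (Ideal.mem_span_singleton_self _)

/-- Pulling the power back to `k[x, y]` gives a monomial ideal, so that membership of monomials
becomes a comparison of exponents. -/
theorem mk_mem_stairPowerIdeal_pow_iff (n : ℕ) (f : MvPolynomial (Fin 2) k) :
    Ideal.Quotient.mk (stairIdeal k d m b) f ∈ stairPowerIdeal k d m b ^ n ↔
      f ∈ Ideal.span ((fun p : ℕ × ℕ => X 0 ^ p.1 * X 1 ^ p.2) ''
        insert (0, d * n) {p | ∃ i ≤ m, p = (b i, d * i)}) := by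
  have himage : (fun p : ℕ × ℕ => (X 0 ^ p.1 * X 1 ^ p.2 : MvPolynomial (Fin 2) k)) ''
      insert (0, d * n) {p | ∃ i ≤ m, p = (b i, d * i)} =
        {X 1 ^ (d * n)} ∪ {f | ∃ i ≤ m, f = X 0 ^ b i * X 1 ^ (d * i)} := by
    ext f
    simp only [Set.mem_image, Set.mem_insert_iff, Set.mem_ofPred_eq, Set.mem_union,
      Set.mem_singleton_iff]
    constructor
    · rintro ⟨p, rfl | ⟨i, hi, rfl⟩, rfl⟩
      · simp
      · exact Or.inr ⟨i, hi, rfl⟩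
    · rintro (rfl | ⟨i, hi, rfl⟩)
      · exact ⟨_, Or.inl rfl, by simp⟩
      · exact ⟨_, Or.inr ⟨i, hi, rfl⟩, rfl⟩
  rw [himage, Ideal.span_union, stairPowerIdeal_pow, ← Set.image_singleton, ← Ideal.map_span,
    ← Ideal.mem_comap, Ideal.comap_map_of_surjective _ Ideal.Quotient.mk_surjective,
    ← RingHom.ker_eq_comap_bot, Ideal.mk_ker, stairIdeal]

/-- The corner monomial of the `n`-th step, attaining the top degree. Generators with `i ≤ n` have
too large an `x`-exponent, as `b i ≥ b n`; those with `i > n`, and `y ^ (d * (n + 1))`, have too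
large a `y`-exponent. -/
theorem mk_X_pow_mul_X_pow_notMem_stairPowerIdeal_pow (hd : 1 ≤ d) (hb : ∀ n, 1 ≤ b n)
    (hanti : Antitone b) (n : ℕ) :
    Ideal.Quotient.mk (stairIdeal k d m b) (X 0 ^ (b n - 1) * X 1 ^ (d - 1) * X 1 ^ (d * n)) ∉
      stairPowerIdeal k d m b ^ (n + 1) := by
  rw [mk_mem_stairPowerIdeal_pow_iff, mul_assoc, ← pow_add, X_pow_mul_X_pow_mem_span_iff]
  rintro ⟨p, rfl | ⟨i, -, rfl⟩, h₁, h₂⟩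
  · simp only [Nat.mul_add, mul_one] at h₂
    omega
  · simp only at h₁ h₂
    have := hb n
    have hi : ¬i ≤ n := fun h => by have := hanti h; omega
    have : d * (n + 1) ≤ d * i := Nat.mul_le_mul_left d (by omega)
    rw [Nat.mul_add, mul_one] at this
    omega

theorem mk_mul_X_pow_mem_stairPowerIdeal_pow_succ (hbm : ∀ n, m ≤ n → b n = b m) {n e : ℕ}
    (he : b n + d ≤ e + 1) {G : MvPolynomial (Fin 2) k} (hG : G.IsHomogeneous e) :
    Ideal.Quotient.mk (stairIdeal k d m b) (G * X 1 ^ (d * n)) ∈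
      stairPowerIdeal k d m b ^ (n + 1) := by
  rw [mk_mem_stairPowerIdeal_pow_iff, G.as_sum, Finset.sum_mul]
  refine Ideal.sum_mem _ fun v hv => ?_
  have hdeg : v 0 + v 1 = e := by
    have := hG (mem_support_iff.mp hv)
    simpa [Finsupp.weight_apply, Finsupp.sum_fintype] using this
  have hmon : monomial v (coeff v G) * X 1 ^ (d * n) =
      C (coeff v G) * (X 0 ^ v 0 * X 1 ^ (v 1 + d * n)) := by
    rw [monomial_eq, Finsupp.prod_fintype _ _ (by simp), Fin.prod_univ_two]
    ring
  rw [hmon]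
  refine Ideal.mul_mem_left _ _ ?_
  -- Pigeonhole: `v 0 + v 1 ≥ b n + d - 1` forces `v 1 ≥ d` or `v 0 ≥ b n`.
  by_cases hv : d ≤ v 1
  · rw [X_pow_mul_X_pow_mem_span_iff]
    exact ⟨_, Or.inl rfl, Nat.zero_le _, by simp only [Nat.mul_add]; omega⟩
  · have hmem : (X 0 ^ b n * X 1 ^ (d * n) : MvPolynomial (Fin 2) k) ∈ stairIdeal k d m b :=
      X_pow_mul_X_pow_mem_stairIdeal hbm n
    rw [← mk_mem_stairPowerIdeal_pow_iff,
      show v 0 = (v 0 - b n) + b n by omega, pow_add, pow_add,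
      show (X 0 ^ (v 0 - b n) * X 0 ^ b n * (X 1 ^ v 1 * X 1 ^ (d * n)) :
        MvPolynomial (Fin 2) k) = X 0 ^ (v 0 - b n) * X 1 ^ v 1 * (X 0 ^ b n * X 1 ^ (d * n)) by
          ring, Ideal.Quotient.eq_zero_iff_mem.mpr (Ideal.mul_mem_left _ _ hmem)]
    exact zero_mem _

/-- An algebra generated by nilpotents is integral over the field `k`, so all its primes are
maximal. -/
theorem ringKrullDim_eq_zero_of_isNilpotent_X {A : Type*} [CommRing A] [Nontrivial A] [Algebra k A]
    {π : MvPolynomial (Fin 2) k →ₐ[k] A} (hπ : Function.Surjective π)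
    (hX : ∀ i, IsNilpotent (π (X i))) : ringKrullDim A = 0 := by
  have hint : Algebra.IsIntegral k A := by
    rw [← integralClosure_eq_top_iff, eq_top_iff, ← adjoin_image_X_eq_top k hπ,
      Algebra.adjoin_le_iff]
    rintro _ ⟨_, ⟨i, rfl⟩, rfl⟩
    obtain ⟨n, hn⟩ := hX i
    refine IsIntegral.of_pow n.succ_pos ?_
    rw [pow_succ, hn, zero_mul]
    exact isIntegral_zero
  have hdim : Ring.KrullDimLE 0 A := Ring.krullDimLE_zero_iff.mpr fun P hP =>
    Ideal.isMaximal_of_isIntegral_of_isMaximal_comap (R := k) P inferInstance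
  exact le_antisymm (Ring.krullDimLE_iff.mp hdim) ringKrullDim_nonneg_of_nontrivial

theorem ringKrullDim_quotient_stairPowerIdeal (hne : stairPowerIdeal k d m b ≠ ⊤) :
    ringKrullDim (StairRing k d m b ⧸ stairPowerIdeal k d m b) = 0 := by
  have : Nontrivial (StairRing k d m b ⧸ stairPowerIdeal k d m b) :=
    Ideal.Quotient.nontrivial_iff.mpr hne
  let A := StairRing k d m b ⧸ stairPowerIdeal k d m b
  let π : MvPolynomial (Fin 2) k →ₐ[k] A :=
    (Ideal.Quotient.mkₐ k (stairPowerIdeal k d m b)).comp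
      (Ideal.Quotient.mkₐ k (stairIdeal k d m b))
  have hπ : Function.Surjective π :=
    (Ideal.Quotient.mkₐ_surjective k _).comp (Ideal.Quotient.mkₐ_surjective k _)
  refine ringKrullDim_eq_zero_of_isNilpotent_X (A := A) (π := π) hπ
    (Fin.forall_fin_two.mpr ⟨⟨b 0, ?_⟩, ⟨d, ?_⟩⟩)
  · have h : (X 0 ^ b 0 : MvPolynomial (Fin 2) k) ∈ stairIdeal k d m b :=
      Ideal.subset_span ⟨0, Nat.zero_le _, by simp⟩
    rw [← map_pow]
    change Ideal.Quotient.mk _ (Ideal.Quotient.mk _ _) = 0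
    rw [Ideal.Quotient.eq_zero_iff_mem.mpr h, map_zero]
  · rw [← map_pow]
    exact Ideal.Quotient.eq_zero_iff_mem.mpr (Ideal.mem_span_singleton_self _)

theorem stairPowerIdeal_isEquigeneratedDimZero (hd : 1 ≤ d) (hb : ∀ n, 1 ≤ b n)
    (hanti : Antitone b) :
    IsEquigeneratedDimZero (stairGrading k d m b) d (stairPowerIdeal k d m b) := by
  have hne : stairPowerIdeal k d m b ≠ ⊤ := fun h => by
    have := mk_X_pow_mul_X_pow_notMem_stairPowerIdeal_pow (k := k) (m := m) hd hb hanti 0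
    exact this (by rw [h, Ideal.top_pow]; trivial)
  exact
    { generated := ⟨{Ideal.Quotient.mk _ (X 1 ^ d)}, by
        rw [Set.singleton_subset_iff]
        exact ⟨X 1 ^ d, isHomogeneous_X_pow 1 d, rfl⟩, rfl⟩
      ne_top := hne
      pow_ne_bot := fun n _ h => by
        have hmem := mk_X_pow_mem_stairPowerIdeal_pow (m := m) (b := b) (d := d) n
          (X 0 ^ (b n - 1) * X 1 ^ (d - 1) : MvPolynomial (Fin 2) k)
        have hnot := mk_X_pow_mul_X_pow_notMem_stairPowerIdeal_pow (k := k) (m := m) hd hb hanti n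
        rw [h, Ideal.mem_bot] at hmem
        exact hnot (hmem ▸ zero_mem _)
      dim_eq_zero := ringKrullDim_quotient_stairPowerIdeal hne }

theorem le_of_exists_mem_stairPowerIdeal_pow (hbm : ∀ n, m ≤ n → b n = b m) {n : ℕ} {j : ℤ}
    (h : ∃ f ∈ intGrading (stairGrading k d m b) j,
      f ∈ stairPowerIdeal k d m b ^ n ∧ f ∉ stairPowerIdeal k d m b ^ (n + 1)) :
    j ≤ d * (n + 1) + b n - 2 := by
  let := stairGradedAlgebra k d m b
  obtain ⟨f, hfj, hf, hf'⟩ := h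
  cases j with
  | negSucc j => exact absurd (show f = 0 from hfj) fun h0 => hf' (h0 ▸ zero_mem _)
  | ofNat j =>
    have hfj' : f ∈ stairGrading k d m b j := hfj
    by_contra! hj
    refine hf' ?_
    have hj' : b n + d + d * n ≤ j + 1 := by
      rw [Int.ofNat_eq_natCast] at hj
      zify
      linarith
    have hgen : Ideal.Quotient.mk (stairIdeal k d m b) (X 1 ^ (d * n)) ∈
        stairGrading k d m b (d * n) := ⟨_, isHomogeneous_X_pow 1 _, rfl⟩
    rw [stairPowerIdeal_pow, Ideal.mem_span_singleton'] at hf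
    obtain ⟨g, rfl⟩ := hf
    -- Since `y ^ (d * n)` is homogeneous, the cofactor `g` may be replaced by its component of
    -- degree `j - d * n`, which lifts to a form `G`.
    rw [← DirectSum.decompose_of_mem_same _ hfj']
    by_cases hle : d * n ≤ j
    · rw [DirectSum.coe_decompose_mul_of_right_mem_of_le _ hgen hle]
      obtain ⟨G, hG, hGeq⟩ := (DirectSum.decompose (stairGrading k d m b) g (j - d * n)).2
      rw [← hGeq]
      change Ideal.Quotient.mk _ G * _ ∈ _
      rw [← map_mul]
      exact mk_mul_X_pow_mem_stairPowerIdeal_pow_succ hbm (by omega) hG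
    · rw [DirectSum.coe_decompose_mul_of_right_mem_of_not_le _ hgen hle]
      exact zero_mem _

theorem exists_mem_stairPowerIdeal_pow (hd : 1 ≤ d) (hb : ∀ n, 1 ≤ b n) (hanti : Antitone b)
    (n : ℕ) : ∃ f ∈ intGrading (stairGrading k d m b) (d * (n + 1) + b n - 2),
      f ∈ stairPowerIdeal k d m b ^ n ∧ f ∉ stairPowerIdeal k d m b ^ (n + 1) := by
  refine ⟨_, ?_, mk_X_pow_mem_stairPowerIdeal_pow n (X 0 ^ (b n - 1) * X 1 ^ (d - 1)),
    mk_X_pow_mul_X_pow_notMem_stairPowerIdeal_pow hd hb hanti n⟩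
  have hj : (d * (n + 1) + b n - 2 : ℤ) = ((b n - 1 + (d - 1) + d * n : ℕ) : ℤ) := by
    have := hb n
    push_cast [Nat.cast_sub this, Nat.cast_sub hd]
    ring
  rw [hj]
  exact ⟨_, ((isHomogeneous_X_pow 0 _).mul (isHomogeneous_X_pow 1 _)).mul
    (isHomogeneous_X_pow 1 _), rfl⟩

theorem regPowQuotient_stairPowerIdeal (hd : 1 ≤ d) (hb : ∀ n, 1 ≤ b n) (hanti : Antitone b)
    (hbm : ∀ n, m ≤ n → b n = b m) (n : ℕ) :
    letI := stairGradedAlgebra k d m b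
    letI := stairGrading_isStandardGraded k d m b
    regPowQuotient (stairGrading k d m b) (stairPowerIdeal k d m b) (n + 1) =
      ((d * (n + 1) + b n - 2 : ℤ) : WithTop ℤ) := by
  let := stairGradedAlgebra k d m b
  let := stairGrading_isStandardGraded k d m b
  rw [regPowQuotient_eq_iSup _ (stairPowerIdeal_isEquigeneratedDimZero hd hb hanti)]
  refine le_antisymm (iSup₂_le fun j hj => ?_)
    (le_iSup₂_of_le _ (exists_mem_stairPowerIdeal_pow hd hb hanti n) le_rfl)
  rw [WithBot.coe_le_coe, WithTop.coe_le_coe]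
  exact le_of_exists_mem_stairPowerIdeal_pow hbm hj

end Stair

/-! ### The characterization of defect sequences. -/

theorem AntitoneOn.exists_forall_ge_eq {c : ℕ → ℕ} (hc : AntitoneOn c (Set.Ici 1)) :
    ∃ m, ∀ n, m ≤ n → c (n + 1) = c (m + 1) := by
  let f : ℕ → ℕ := fun n => c (n + 1)
  -- A weakly decreasing sequence stays constant once it attains its minimum.
  refine ⟨Function.argmin f, fun n hn => le_antisymm ?_ (Function.argmin_le f n)⟩
  exact hc (by simp) (by simp) (Nat.add_le_add_right hn 1)

theorem theorem1p5 (k : Type u) [Field k] (d : ℕ) (hd : 1 ≤ d) :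
    (∀ c : ℕ → ℕ,
      (∃ (R : Type u) (_ : CommRing R) (_ : Algebra k R) (𝒜 : ℕ → Submodule k R)
          (_ : GradedAlgebra 𝒜) (_ : IsStandardGraded 𝒜) (I : Ideal R),
          IsEquigeneratedDimZero 𝒜 d I ∧ IsDefectSequence 𝒜 d I c) ↔
        AntitoneOn c (Set.Ici 1)) ∧
    (∀ (b : ℕ → ℕ) (m : ℕ), (∀ n, 1 ≤ b n) → Antitone b → (∀ n, m ≤ n → b n = b m) →
      ∃ (_ : GradedAlgebra (stairGrading k d m b)) (_ : IsStandardGraded (stairGrading k d m b)),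
        IsEquigeneratedDimZero (stairGrading k d m b) d (stairPowerIdeal k d m b) ∧
        ∀ n : ℕ, regPowQuotient (stairGrading k d m b) (stairPowerIdeal k d m b) (n + 1) =
          ((d * (n + 1) + b n - 2 : ℤ) : WithTop ℤ)) := by
  refine ⟨fun c => ⟨?_, fun hc => ?_⟩, fun b m hb hanti hbm =>
    ⟨stairGradedAlgebra k d m b, stairGrading_isStandardGraded k d m b,
      stairPowerIdeal_isEquigeneratedDimZero hd hb hanti,
      regPowQuotient_stairPowerIdeal hd hb hanti hbm⟩⟩
  · rintro ⟨R, _, _, 𝒜, _, _, I, hI, hIc⟩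
    exact hIc.antitoneOn 𝒜 hI
  · obtain ⟨m, hm⟩ := hc.exists_forall_ge_eq
    -- The index shift matches `n ≥ 0` with `n ≥ 1`; the added `1` makes `b` positive and inverts `c
    -- n = b (n - 1) - 1`.
    let b : ℕ → ℕ := fun n => c (n + 1) + 1
    have hb (n : ℕ) : 1 ≤ b n := Nat.le_add_left _ _
    have hanti : Antitone b := fun i j hij =>
      Nat.add_le_add_right (hc (by simp) (by simp) (Nat.add_le_add_right hij 1)) 1
    have hbm (n : ℕ) (hn : m ≤ n) : b n = b m := congrArg (· + 1) (hm n hn)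
    refine ⟨StairRing k d m b, inferInstance, inferInstance, stairGrading k d m b,
      stairGradedAlgebra k d m b, stairGrading_isStandardGraded k d m b, stairPowerIdeal k d m b,
      stairPowerIdeal_isEquigeneratedDimZero hd hb hanti, fun n hn => ?_⟩
    obtain ⟨n, rfl⟩ : ∃ n', n = n' + 1 := ⟨n - 1, by omega⟩
    rw [regPowQuotient_stairPowerIdeal hd hb hanti hbm]
    congr 2
    simp only [b]
    push_cast
    ring
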